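/- Let $p$ be an even positive integer, let $d\ge 2$ and $n\ge 3$ be integers, and let $G$ be a finite simple graph with vertex set $\{1,\dots,n\}$ and edge set $E$ that has no isolated vertices. Define $f_p:\mathbb{C}^n\to\mathbb{C}^{\binom n2}$ by $f_p(x)_{ij}=(x_i-x_j)^p$ for $1\le i<j\le n$, and let $\mathcal{CM}_n^p$ be the Zariski closure of the image of $f_p$. Let $\pi_G:\mathbb{C}^{\binom n2}\to\mathbb{C}^{E}$ be the projection onto the coordinates indexed by the edges of $G$, and let $\mathcal V=\overline{\pi_G(\mathcal{CM}_n^p)}\subseteq\mathbb{C}^E$, where the bar denotes the Zariski closure. The $d$-secant $S_d(\mathcal V)$ is the Zariski closure of the union of all linear subspaces spanned by $d$ points of $\mathcal V$. A point $z\in S_d(\mathcal V)$ is called generic if every polynomial with rational coefficients that vanishes at $z$ vanishes on all of $S_d(\mathcal V)$. The cone $\mathcal V$ is called $d$-identifiable over $\mathbb{C}$ if every generic point $z\in S_d(\mathcal V)$ can be written as $z=\sum_{k=1}^d x_k$ with $x_1,\dots,x_d\in\mathcal V$, and these points are unique up to a scaling of each of them and a permutation of the indices; that is, if also $z=\sum_{k=1}^d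 y_k$ with $y_1,\dots,y_d\in\mathcal V$, then there are a permutation $\sigma$ of $\{1,\dots,d\}$ and scalars $\lambda_1,\dots,\lambda_d\in\mathbb{C}$ with $y_k=\lambda_k x_{\sigma(k)}$ for all $k$. Let $\ell_p^d$ be $\mathbb{R}^d$ with the distance $\|x-y\|_p=\bigl(\sum_{k=1}^d (x_k-y_k)^p\bigr)^{1/p}$. A framework $(G,\mathbf p)$ in $\ell_p^d$, with $\mathbf p:\{1,\dots,n\}\to\mathbb{R}^d$, is called generic if its $dn$ coordinates are algebraically independent over $\mathbb{Q}$. It is called globally rigid in $\ell_p^d$ if for every $\mathbf q:\{1,\dots,n\}\to\mathbb{R}^d$ with $\|\mathbf q(i)-\mathbf q(j)\|_p=\|\mathbf p(i)-\mathbf p(j)\|_p$ for all $ij\in E$ there is an isometry $\iota$ of $\ell_p^d$ onto itself with $\mathbf q(i)=\iota(\mathbf p(i))$ for all $i$. If $\mathcal V$ is $d$-identifiable over $\mathbb{C}$, then every generic framework $(G,\mathbf p)$ in $\ell_p^d$ is globally rigid in $\ell_p^d$. -/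

import Mathlib

open scoped ENNReal

noncomputable section

namespace LpRigidity

/-! ### Frameworks in `ℓ_p^d` -/

/-- The `d`-dimensional `ℓ_p`-space: `ℝ^d` with the distance `(∑ k, |x_k - y_k| ^ p) ^ (1 / p)`. -/
abbrev LpSpace (p d : ℕ) : Type := PiLp (p : ℝ≥0∞) (fun _ : Fin d => ℝ)

/-- A point configuration of `n` points is generic if its `d n` coordinates are algebraically
independent over `ℚ`. -/
def IsGenericConfig {p d n : ℕ} (P : Fin n → LpSpace p d) : Prop :=
  AlgebraicIndependent ℚ (fun ik : Fin n × Fin d => P ik.1 ik.2)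

/-- The frameworks `(G, P)` and `(G, Q)` are equivalent: corresponding edges have equal length. -/
def AreEquivalent {p d n : ℕ} (G : SimpleGraph (Fin n)) (P Q : Fin n → LpSpace p d) : Prop :=
  ∀ i j, G.Adj i j → dist (P i) (P j) = dist (Q i) (Q j)

/-- `Q` is the image of `P` under an isometry of `ℓ_p^d` onto itself. -/
def AreCongruent {p d n : ℕ} (P Q : Fin n → LpSpace p d) : Prop :=
  ∃ φ : LpSpace p d ≃ LpSpace p d,
    (∀ x y, dist (φ x) (φ y) = dist x y) ∧ ∀ i, Q i = φ (P i)

/-- `(G, P)` is globally rigid in `ℓ_p^d`: every framework equivalent to it is congruent to it. -/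
def IsGloballyRigid {p d n : ℕ} (G : SimpleGraph (Fin n)) (P : Fin n → LpSpace p d) : Prop :=
  ∀ Q : Fin n → LpSpace p d, AreEquivalent G P Q → AreCongruent P Q

/-! ### Affine varieties in `ℂ^ι`, secants and identifiability -/

/-- The Zariski closure of a subset of the affine space `ℂ^ι`. -/
def zariskiClosure {ι : Type*} (S : Set (ι → ℂ)) : Set (ι → ℂ) :=
  MvPolynomial.zeroLocus ℂ (MvPolynomial.vanishingIdeal ℂ S)

/-- The `d`-secant of `X`: the Zariski closure of the union of the linear subspaces spanned by
`d` points of `X`. -/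
def secant {ι : Type*} (d : ℕ) (X : Set (ι → ℂ)) : Set (ι → ℂ) :=
  zariskiClosure {z | ∃ x : Fin d → ι → ℂ, (∀ k, x k ∈ X) ∧ z ∈ Submodule.span ℂ (Set.range x)}

/-- A point `x` of `X` is generic if every polynomial with rational coefficients that vanishes
at `x` vanishes at every point of `X`. -/
def IsGenericPoint {ι : Type*} (X : Set (ι → ℂ)) (x : ι → ℂ) : Prop :=
  x ∈ X ∧ ∀ f : MvPolynomial ι ℚ,
    MvPolynomial.aeval x f = 0 → ∀ y ∈ X, MvPolynomial.aeval y f = 0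

/-- `x` is a decomposition of `z` into a sum of `d` points of `X`. -/
def IsDecomposition {ι : Type*} {d : ℕ} (X : Set (ι → ℂ)) (z : ι → ℂ) (x : Fin d → ι → ℂ) :
    Prop :=
  (∀ k, x k ∈ X) ∧ ∑ k, x k = z

/-- A cone `X` is `d`-identifiable (over `ℂ`) if every generic point of its `d`-secant is the sum
of `d` points of `X`, which are unique up to a scaling of each of them and a permutation.
As the two decompositions below may be exchanged, the scalars can be taken nonzero. -/
def IsIdentifiable {ι : Type*} (d : ℕ) (X : Set (ι → ℂ)) : Prop :=
  ∀ z, IsGenericPoint (secant d X) z →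
    (∃ x : Fin d → ι → ℂ, IsDecomposition X z x) ∧
    ∀ x y : Fin d → ι → ℂ, IsDecomposition X z x → IsDecomposition X z y →
      ∃ (σ : Equiv.Perm (Fin d)) (c : Fin d → ℂ), ∀ k, y k = c k • x (σ k)

/-! ### The `p`-Cayley-Menger variety and its coordinate projections -/

/-- The pairs `i < j`; they index the coordinates of the affine space of dimension `n choose 2`. -/
abbrev Pair (n : ℕ) : Type := {e : Fin n × Fin n // e.1 < e.2}

/-- The edges of `G`, as a subtype of the pairs `i < j`. -/
abbrev Edge {n : ℕ} (G : SimpleGraph (Fin n)) : Type := {e : Pair n // G.Adj e.1.1 e.1.2}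

/-- The map `f_p` that sends `x` to `((x_i - x_j) ^ p)_{i < j}`. -/
def powerMap (n p : ℕ) (x : Fin n → ℂ) : Pair n → ℂ :=
  fun e => (x e.1.1 - x e.1.2) ^ p

/-- The `p`-Cayley-Menger variety: the Zariski closure of the image of `f_p`. -/
def cayleyMenger (n p : ℕ) : Set (Pair n → ℂ) :=
  zariskiClosure (Set.range (powerMap n p))

/-- The projection `π_G` onto the coordinates indexed by the edges of `G`. -/
def edgeProj {n : ℕ} (G : SimpleGraph (Fin n)) (y : Pair n → ℂ) : Edge G → ℂ :=
  fun e => y e.1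

/-- The Zariski closure of the projection of the `p`-Cayley-Menger variety along `π_G`. -/
def projectedCayleyMenger {n : ℕ} (G : SimpleGraph (Fin n)) (p : ℕ) : Set (Edge G → ℂ) :=
  zariskiClosure (edgeProj G '' cayleyMenger n p)

end LpRigidity

end

/-!
Write `x_k` for the `k`-th coordinate column of the generic configuration and `f(x)` for the vector
of the `(x_i - x_j) ^ p` over the edges. The `p`-th powers of the edge lengths form the vector
`z = ∑ k, f(x_k)`, and an equivalent configuration with columns `y_k` is a second decomposition of
`z`. As `z` is the value of a rational polynomial map at an algebraically independent point, and
the values of this map are dense in the secant, `z` is a generic point of it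
(`isGenericPoint_sum_edgePower`). Identifiability gives `f(y_k) = c_k f(x_{σ k})`. The `f(x_k)` are
linearly independent (`linearIndependent_edgePower`), hence all `c_k` equal `1`, so that
`y_{k,i} - y_{k,j} = ± (x_{σ k,i} - x_{σ k,j})` on each edge, with a sign depending on the edge.

It remains to see that the sign is the same on all edges and that `G` is connected. Otherwise the
edges would fall into two nonempty classes such that a column is a sum of two vectors, each of
which has zero differences on one of the classes (`split_trivial`). The existence of such a
splitting is a system of `ℚ`-linear equations, so a `ℚ`-linear map `ℝ → ℝ` sending the first column
to a second one (there is one, as `d ≥ 2`) carries it over. Exchanging the parts of the two columns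
on one class of edges gives a decomposition of `z` that identifiability forbids. Hence
`y_k = ± x_{σ k} + t_k`, and a signed permutation of the coordinates followed by a translation is
the required isometry.
-/

namespace LpRigidity

open MvPolynomial

/-! ### Zariski closures -/

theorem mem_zariskiClosure_iff {ι : Type*} {S : Set (ι → ℂ)} {z : ι → ℂ} :
    z ∈ zariskiClosure S ↔
      ∀ g : MvPolynomial ι ℂ, (∀ s ∈ S, aeval s g = 0) → aeval z g = 0 := by
  simp [zariskiClosure, mem_zeroLocus_iff, mem_vanishingIdeal_iff]

theorem subset_zariskiClosure {ι : Type*} (S : Set (ι → ℂ)) : S ⊆ zariskiClosure S :=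
  fun _ hz => mem_zariskiClosure_iff.2 fun _ hg => hg _ hz

/-- A polynomial that vanishes on a linear combination of points of `S`, whichever points are
taken, vanishes on the same combination of points of the Zariski closure of `S`: the points can be
moved into the closure one at a time, the polynomial being a polynomial in each of them. -/
theorem aeval_sum_smul_eq_zero_of_mem_zariskiClosure {ι κ : Type*} [Fintype κ]
    {S : Set (ι → ℂ)} (g : MvPolynomial ι ℂ) (a : κ → ℂ)
    (hS : ∀ v : κ → ι → ℂ, (∀ k, v k ∈ S) → aeval (∑ k, a k • v k) g = 0)
    (v : κ → ι → ℂ) (hv : ∀ k, v k ∈ zariskiClosure S) : aeval (∑ k, a k • v k) g = 0 := by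
  classical
  suffices H : ∀ T : Finset κ, ∀ v : κ → ι → ℂ, (∀ k ∈ T, v k ∈ zariskiClosure S) →
      (∀ k ∉ T, v k ∈ S) → aeval (∑ k, a k • v k) g = 0 from
    H Finset.univ v (fun k _ => hv k) (fun k hk => absurd (Finset.mem_univ k) hk)
  intro T
  induction T using Finset.induction_on with
  | empty => exact fun v _ h => hS v fun k => h k (by simp)
  | insert m T hm ih =>
    intro v h1 h2
    -- the value of `g` as a polynomial in the `m`-th point alone
    let r : ι → ℂ := ∑ k ∈ Finset.univ.erase m, a k • v k
    have key : ∀ w : ι → ℂ, aeval w (bind₁ (fun i => C (r i) + C (a m) * X i) g) =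
        aeval (∑ k, a k • Function.update v m w k) g := by
      intro w
      rw [aeval_bind₁]
      congr 2
      ext i
      rw [← Finset.add_sum_erase _ _ (Finset.mem_univ m)]
      have : ∑ k ∈ Finset.univ.erase m, a k • Function.update v m w k = r :=
        Finset.sum_congr rfl fun k hk => by
          rw [Function.update_of_ne (Finset.ne_of_mem_erase hk)]
      rw [this]
      simp [add_comm]
    have := mem_zariskiClosure_iff.1 (h1 m (Finset.mem_insert_self _ _))
      (bind₁ (fun i => C (r i) + C (a m) * X i) g) fun s hs => by
        rw [key]
        refine ih _ (fun k hk => ?_) fun k hk => ?_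
        · have hkm : k ≠ m := fun h => hm (h ▸ hk)
          rw [Function.update_of_ne hkm]
          exact h1 k (Finset.mem_insert_of_mem hk)
        · by_cases hkm : k = m
          · subst hkm; simpa using hs
          · rw [Function.update_of_ne hkm]
            exact h2 k (by simp [hk, hkm])
    rwa [key, Function.update_eq_self] at this

/-! ### The edge map and generic points of the secant -/

/-- The map `x ↦ ((x_i - x_j) ^ p)` onto the coordinates indexed by the edges of `G`. -/
def edgePower {n : ℕ} (G : SimpleGraph (Fin n)) (p : ℕ) (x : Fin n → ℂ) : Edge G → ℂ :=
  edgeProj G (powerMap n p x)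

theorem edgePower_apply {n : ℕ} (G : SimpleGraph (Fin n)) (p : ℕ) (x : Fin n → ℂ) (e : Edge G) :
    edgePower G p x e = (x e.1.1.1 - x e.1.1.2) ^ p := rfl

theorem edgePower_mem {n : ℕ} (G : SimpleGraph (Fin n)) (p : ℕ) (x : Fin n → ℂ) :
    edgePower G p x ∈ projectedCayleyMenger G p :=
  subset_zariskiClosure _ ⟨_, subset_zariskiClosure _ ⟨x, rfl⟩, rfl⟩

theorem projectedCayleyMenger_subset {n : ℕ} (G : SimpleGraph (Fin n)) (p : ℕ) :
    projectedCayleyMenger G p ⊆ zariskiClosure (Set.range (edgePower G p)) := by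
  intro z hz
  rw [mem_zariskiClosure_iff]
  intro g hg
  refine mem_zariskiClosure_iff.1 hz g ?_
  rintro _ ⟨y, hy, rfl⟩
  have := mem_zariskiClosure_iff.1 hy (rename Subtype.val g) (by
    rintro _ ⟨x, rfl⟩
    rw [aeval_rename]
    exact hg _ ⟨x, rfl⟩)
  rwa [aeval_rename] at this

/-- Over `ℂ` the image of `edgePower` is a cone, as scalars have `p`-th roots. -/
theorem exists_edgePower_eq_smul {n p : ℕ} (hp : 0 < p) (G : SimpleGraph (Fin n)) (c : ℂ)
    (x : Fin n → ℂ) : ∃ y, edgePower G p y = c • edgePower G p x := by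
  obtain ⟨b, rfl⟩ := IsAlgClosed.exists_pow_nat_eq c hp
  refine ⟨b • x, ?_⟩
  ext e
  simp [edgePower_apply, ← mul_sub, mul_pow]

/-- The sum of the images of algebraically independent vectors is a generic point of the secant:
a rational polynomial that vanishes there vanishes identically on all such sums, and these are
Zariski dense in the secant. -/
theorem isGenericPoint_sum_edgePower {n d p : ℕ} (hp : 0 < p) (G : SimpleGraph (Fin n))
    (x : Fin d → Fin n → ℂ)
    (hx : AlgebraicIndependent ℚ (fun ik : Fin n × Fin d => x ik.2 ik.1)) :
    IsGenericPoint (secant d (projectedCayleyMenger G p)) (∑ k, edgePower G p (x k)) := by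
  refine ⟨subset_zariskiClosure _ ⟨fun k => edgePower G p (x k), fun k => edgePower_mem _ _ _,
    Submodule.sum_mem _ fun k _ => Submodule.subset_span ⟨k, rfl⟩⟩, fun f hf y hy => ?_⟩
  have key : ∀ w : Fin d → Fin n → ℂ,
      aeval (fun ik : Fin n × Fin d => w ik.2 ik.1) (bind₁ (fun e : Edge G =>
        ∑ k, (X (e.1.1.1, k) - X (e.1.1.2, k) : MvPolynomial (Fin n × Fin d) ℚ) ^ p) f) =
      aeval (∑ k, edgePower G p (w k)) f := by
    intro w
    rw [aeval_bind₁]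
    congr 2
    ext e
    simp [edgePower_apply]
  have h0 := (algebraicIndependent_iff.1 hx) _ ((key x).trans hf)
  have hsum : ∀ w : Fin d → Fin n → ℂ, aeval (∑ k, edgePower G p (w k)) f = 0 := by
    intro w
    rw [← key w, h0, map_zero]
  have hmap : ∀ w : Edge G → ℂ, aeval w (map (algebraMap ℚ ℂ) f) = aeval w f :=
    fun w => aeval_map_algebraMap ℂ w f
  rw [← hmap]
  refine mem_zariskiClosure_iff.1 hy _ ?_
  rintro z ⟨v, hv, hz⟩
  obtain ⟨a, rfl⟩ := (Submodule.mem_span_range_iff_exists_fun ℂ).1 hz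
  refine aeval_sum_smul_eq_zero_of_mem_zariskiClosure _ a (fun w hw => ?_) v
    fun k => projectedCayleyMenger_subset G p (hv k)
  choose u hu using hw
  choose t ht using fun k => exists_edgePower_eq_smul hp G (a k) (u k)
  rw [hmap]
  simp only [← hu, ← ht]
  exact hsum t

/-! ### Consequences of identifiability -/

/-- Algebraically independent vectors have linearly independent images if the variety is
`d`-identifiable. A linear relation would give a second decomposition of their sum, one of whose
points is `0`; but then one of the images would vanish too. -/
theorem linearIndependent_edgePower {n d p : ℕ} (hp : 0 < p) (G : SimpleGraph (Fin n))
    (hident : IsIdentifiable d (projectedCayleyMenger G p)) (x : Fin d → Fin n → ℂ)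
    (hx : AlgebraicIndependent ℚ (fun ik : Fin n × Fin d => x ik.2 ik.1))
    (e : Edge G) : LinearIndependent ℂ (fun k => edgePower G p (x k)) := by
  rw [Fintype.linearIndependent_iff]
  intro a ha m
  by_contra hm
  -- subtracting the multiple `1 / a m` of the relation makes the coefficient at `m` vanish
  choose t ht using fun k => exists_edgePower_eq_smul hp G (1 - a k / a m) (x k)
  have hdec : ∑ k, edgePower G p (t k) = ∑ k, edgePower G p (x k) := by
    have : ∑ k, (a k / a m) • edgePower G p (x k) = 0 := by
      simp only [div_eq_inv_mul, mul_smul, ← Finset.smul_sum, ha, smul_zero]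
    simp only [ht, sub_smul, one_smul, Finset.sum_sub_distrib, this, sub_zero]
  obtain ⟨σ, c, h⟩ := (hident _ (isGenericPoint_sum_edgePower hp G x hx)).2
    (fun k => edgePower G p (t k)) (fun k => edgePower G p (x k))
    ⟨fun k => edgePower_mem _ _ _, hdec⟩ ⟨fun k => edgePower_mem _ _ _, rfl⟩
  have h1 := congrFun (h (σ.symm m)) e
  simp only [Equiv.apply_symm_apply, ht, div_self hm, sub_self, zero_smul, smul_zero,
    edgePower_apply, Pi.zero_apply] at h1
  have h2 := sub_eq_zero.1 (pow_eq_zero_iff hp.ne' |>.1 h1)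
  have h3 := @AlgebraicIndependent.injective _ _ _ _ _ _ _ hx _ (e.1.1.1, σ.symm m) (e.1.1.2, σ.symm m) h2
  exact e.1.2.ne (Prod.ext_iff.1 h3).1

/-- The columns of an equivalent configuration have, up to a permutation, the same images as the
columns of the generic one. -/
theorem exists_perm_pow_sub_eq {n d p : ℕ} (hp : 0 < p) (hpe : Even p) (G : SimpleGraph (Fin n))
    (hident : IsIdentifiable d (projectedCayleyMenger G p)) (x : Fin d → Fin n → ℝ)
    (hx : AlgebraicIndependent ℚ (fun ik : Fin n × Fin d => x ik.2 ik.1))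
    (y : Fin d → Fin n → ℝ)
    (hy : ∀ i j, G.Adj i j → ∑ k, (y k i - y k j) ^ p = ∑ k, (x k i - x k j) ^ p) :
    ∃ σ : Equiv.Perm (Fin d), ∀ k i j, G.Adj i j →
      (y k i - y k j) ^ p = (x (σ k) i - x (σ k) j) ^ p := by
  let xc : Fin d → Fin n → ℂ := fun k i => x k i
  let yc : Fin d → Fin n → ℂ := fun k i => y k i
  have hxc : AlgebraicIndependent ℚ (fun ik : Fin n × Fin d => xc ik.2 ik.1) :=
    hx.map' (f := (Algebra.ofId ℝ ℂ).restrictScalars ℚ) Complex.ofReal_injective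
  have hdec : ∑ k, edgePower G p (yc k) = ∑ k, edgePower G p (xc k) := by
    ext e
    simp only [Finset.sum_apply, edgePower_apply, xc, yc]
    exact_mod_cast hy _ _ e.2
  obtain ⟨σ, c, h⟩ := (hident _ (isGenericPoint_sum_edgePower hp G xc hxc)).2
    (fun k => edgePower G p (xc k)) (fun k => edgePower G p (yc k))
    ⟨fun k => edgePower_mem _ _ _, rfl⟩ ⟨fun k => edgePower_mem _ _ _, hdec⟩
  have hlt : ∀ k (e : Edge G), (y k e.1.1.1 - y k e.1.1.2) ^ p =
      (x (σ k) e.1.1.1 - x (σ k) e.1.1.2) ^ p := by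
    intro k e
    have hli := linearIndependent_edgePower hp G hident xc hxc e
    have hc : c k = 1 := by
      have h0 : ∑ k, (c k - 1) • edgePower G p (xc (σ k)) = 0 := by
        simp only [sub_smul, one_smul, Finset.sum_sub_distrib, ← h, hdec]
        rw [Equiv.sum_comp σ fun k => edgePower G p (xc k), sub_self]
      exact sub_eq_zero.1
        (Fintype.linearIndependent_iff.1 (hli.comp σ σ.injective) (fun k => c k - 1) h0 k)
    have := congrFun (h k) e
    rw [hc, one_smul] at this
    simp only [edgePower_apply, xc, yc] at this
    exact_mod_cast this
  refine ⟨σ, fun k i j hij => ?_⟩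
  rcases lt_or_gt_of_ne hij.ne with hlt' | hgt
  · exact hlt k ⟨⟨(i, j), hlt'⟩, hij⟩
  · have := hlt k ⟨⟨(j, i), hgt⟩, hij.symm⟩
    rwa [← hpe.neg_pow, neg_sub, ← hpe.neg_pow (x _ _ - _), neg_sub] at this

/-! ### Splittings of generic columns -/

/-- Linearly independent reals can be sent to arbitrary reals by a `ℚ`-linear map. -/
theorem exists_linearMap_apply_eq {ι : Type*} {v : ι → ℝ} (hv : LinearIndependent ℚ v)
    (w : ι → ℝ) : ∃ φ : ℝ →ₗ[ℚ] ℝ, ∀ i, φ (v i) = w i := by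
  obtain ⟨φ, hφ⟩ := LinearMap.exists_extend ((Module.Basis.span hv).constr ℚ w)
  refine ⟨φ, fun i => ?_⟩
  have h := (Module.Basis.span hv).constr_basis ℚ w i
  rw [← hφ] at h
  simpa [Module.Basis.span_apply] using h

/-- Distinct columns of a generic configuration never have the same length on an edge. -/
theorem eq_of_pow_sub_eq {n d p : ℕ} (hp : 0 < p) {x : Fin d → Fin n → ℝ}
    (hx : LinearIndependent ℚ (fun ik : Fin n × Fin d => x ik.2 ik.1)) {k l : Fin d}
    {i j : Fin n} (hij : i ≠ j) (h : (x k i - x k j) ^ p = (x l i - x l j) ^ p) : k = l := by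
  by_contra hkl
  -- a `ℚ`-linear map that picks out the coordinate `x k i`
  obtain ⟨φ, hφ⟩ := exists_linearMap_apply_eq hx (Pi.single (i, k) 1)
  have e1 : φ (x k i) = 1 := by simpa using hφ (i, k)
  have e2 : φ (x k j) = 0 := by simpa [hij.symm] using hφ (j, k)
  have e3 : φ (x l i) = 0 := by simpa [Ne.symm hkl] using hφ (i, l)
  have e4 : φ (x l j) = 0 := by simpa [Ne.symm hkl] using hφ (j, l)
  rcases (pow_eq_pow_iff_cases.1 h) with h0 | h0 | ⟨h0, -⟩
  · exact hp.ne' h0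
  · simpa [e1, e2, e3, e4] using congrArg φ h0
  · simpa [e1, e2, e3, e4] using congrArg φ h0

/-- A generic column cannot be split along the edges. If `u` has the edge differences of the
column on some edges and vanishing differences on the others, then one of the two classes of edges
is empty. The splitting consists of `ℚ`-linear equations, so it carries over to a second column;
exchanging the parts of the two columns then gives an equivalent configuration whose columns are
not a permutation of the given ones. -/
theorem split_trivial {n d p : ℕ} (hp : 0 < p) (hpe : Even p) (hd : 2 ≤ d)
    (G : SimpleGraph (Fin n))
    (hident : IsIdentifiable d (projectedCayleyMenger G p)) (x : Fin d → Fin n → ℝ)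
    (hx : AlgebraicIndependent ℚ (fun ik : Fin n × Fin d => x ik.2 ik.1))
    (k : Fin d) (u : Fin n → ℝ)
    (hu : ∀ i j, G.Adj i j → u i - u j = x k i - x k j ∨ u i - u j = 0) :
    (∀ i j, G.Adj i j → u i - u j = x k i - x k j) ∨ ∀ i j, G.Adj i j → u i - u j = 0 := by
  have hlin : LinearIndependent ℚ (fun ik : Fin n × Fin d => x ik.2 ik.1) := hx.linearIndependent
  have : Nontrivial (Fin d) := Fin.nontrivial_iff_two_le.2 hd
  obtain ⟨l, hlk⟩ := exists_ne k
  obtain ⟨φ, hφ⟩ := exists_linearMap_apply_eq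
    (hlin.comp (fun i : Fin n => (i, k)) fun i j h => (Prod.ext_iff.1 h).1) (x l)
  simp only [Function.comp_apply] at hφ
  by_contra! hcon
  obtain ⟨⟨i, j, hij, hne⟩, i', j', hij', hne'⟩ := hcon
  have h1 := (hu i j hij).resolve_left hne
  have h2 := (hu i' j' hij').resolve_right hne'
  have t0 : ∀ a b, u a - u b = 0 → φ (u a) - φ (u b) = 0 := fun a b h => by
    rw [← map_sub, h, map_zero]
  have t1 : ∀ a b, u a - u b = x k a - x k b → φ (u a) - φ (u b) = x l a - x l b :=
    fun a b h => by rw [← map_sub, h, map_sub, hφ, hφ]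
  -- `u` and `φ ∘ u` live on one class of edges, `x k - u` and `x l - φ ∘ u` on the other
  let y : Fin d → Fin n → ℝ := Function.update (Function.update x l (φ ∘ u + (x k - u)))
    k (u + (x l - φ ∘ u))
  have yk : ∀ a, y k a = u a + (x l a - φ (u a)) := fun a => by simp [y]
  have yl : ∀ a, y l a = φ (u a) + (x k a - u a) := fun a => by
    simp [y, Function.update_of_ne hlk]
  have ym : ∀ m, m ≠ k → m ≠ l → y m = x m := fun m hk hl => by
    simp [y, Function.update_of_ne hk, Function.update_of_ne hl]
  obtain ⟨σ, hσ⟩ := exists_perm_pow_sub_eq hp hpe G hident x hx y fun a b hab => by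
    have hsplit : ∀ F : Fin d → ℝ, ∑ m, F m =
        F k + (F l + ∑ m ∈ (Finset.univ.erase k).erase l, F m) := fun F => by
      rw [Finset.add_sum_erase _ _ (by simp [hlk]), Finset.add_sum_erase _ _ (by simp)]
    rw [hsplit, hsplit fun m => (x m a - x m b) ^ p]
    have hrest : ∑ m ∈ (Finset.univ.erase k).erase l, (y m a - y m b) ^ p =
        ∑ m ∈ (Finset.univ.erase k).erase l, (x m a - x m b) ^ p :=
      Finset.sum_congr rfl fun m hm => by
        simp only [Finset.mem_erase] at hm
        rw [ym m hm.2.1 hm.1]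
    rw [hrest, yk, yk, yl, yl]
    rcases hu a b hab with h | h
    · have h' := t1 a b h
      rw [show u a + (x l a - φ (u a)) - (u b + (x l b - φ (u b))) = x k a - x k b by linarith,
        show φ (u a) + (x k a - u a) - (φ (u b) + (x k b - u b)) = x l a - x l b by linarith]
    · have h' := t0 a b h
      rw [show u a + (x l a - φ (u a)) - (u b + (x l b - φ (u b))) = x l a - x l b by linarith,
        show φ (u a) + (x k a - u a) - (φ (u b) + (x k b - u b)) = x k a - x k b by linarith]
      ring
  have e1 := hσ k i j hij
  have e2 := hσ k i' j' hij'
  have h1' := t0 i j h1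
  have h2' := t1 i' j' h2
  rw [yk, yk, show u i + (x l i - φ (u i)) - (u j + (x l j - φ (u j))) = x l i - x l j by
    linarith] at e1
  rw [yk, yk, show u i' + (x l i' - φ (u i')) - (u j' + (x l j' - φ (u j'))) = x k i' - x k j' by
    linarith] at e2
  exact hlk ((eq_of_pow_sub_eq hp hlin hij.ne e1).trans
    (eq_of_pow_sub_eq hp hlin hij'.ne e2).symm)

/-- Two connected components, each of which has an edge, would split a generic column. -/
theorem preconnected_of_isIdentifiable {n d p : ℕ} (hp : 0 < p) (hpe : Even p) (hd : 2 ≤ d)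
    (G : SimpleGraph (Fin n)) (hG : ∀ v, ¬ G.IsIsolated v)
    (hident : IsIdentifiable d (projectedCayleyMenger G p)) (x : Fin d → Fin n → ℝ)
    (hx : AlgebraicIndependent ℚ (fun ik : Fin n × Fin d => x ik.2 ik.1)) :
    G.Preconnected := by
  classical
  intro v w
  by_contra hvw
  let k : Fin d := ⟨0, by omega⟩
  have hnbr : ∀ v, ∃ v', G.Adj v v' := fun v => by
    simpa [SimpleGraph.IsIsolated] using hG v
  obtain ⟨v', hv'⟩ := hnbr v
  obtain ⟨w', hw'⟩ := hnbr w
  have hne : ∀ a b, G.Adj a b → x k a - x k b ≠ 0 := fun a b hab h => by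
    have := @AlgebraicIndependent.injective _ _ _ _ _ _ _ hx _ (a, k) (b, k) (sub_eq_zero.1 h)
    exact hab.ne (Prod.ext_iff.1 this).1
  have hww' : ¬ G.Reachable v w' := fun h => hvw (h.trans hw'.symm.reachable)
  rcases split_trivial hp hpe hd G hident x hx k
    (fun i => if G.Reachable v i then x k i else 0) (fun i j hij => by
      have : G.Reachable v i ↔ G.Reachable v j :=
        ⟨fun h => h.trans hij.reachable, fun h => h.trans hij.symm.reachable⟩
      by_cases h : G.Reachable v j <;> simp [this, h]) with h | h
  · have := h w w' hw'
    simp only [hvw, hww', if_false, sub_zero] at this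
    exact hne w w' hw' this.symm
  · have := h v v' hv'
    simp only [SimpleGraph.Reachable.refl, hv'.reachable, if_true] at this
    exact hne v v' hv' this

/-- A vector with the same edge lengths as a generic column is obtained from it by an isometry of
the line. -/
theorem exists_sign_of_pow_sub_eq {n d p : ℕ} (hp : 0 < p) (hpe : Even p) (hd : 2 ≤ d)
    (G : SimpleGraph (Fin n)) (hG : ∀ v, ¬ G.IsIsolated v)
    (hident : IsIdentifiable d (projectedCayleyMenger G p)) (x : Fin d → Fin n → ℝ)
    (hx : AlgebraicIndependent ℚ (fun ik : Fin n × Fin d => x ik.2 ik.1))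
    (k : Fin d) (y : Fin n → ℝ)
    (hy : ∀ i j, G.Adj i j → (y i - y j) ^ p = (x k i - x k j) ^ p) :
    ∃ (ε : ℤˣ) (t : ℝ), ∀ i, y i = ((ε : ℤ) : ℝ) * x k i + t := by
  have hconn := preconnected_of_isIdentifiable hp hpe hd G hG hident x hx
  have hconst : ∀ g : Fin n → ℝ, (∀ i j, G.Adj i j → g i = g j) → ∃ t, ∀ i, g i = t := by
    intro g hg
    have hreach : ∀ i j, g i = g j := fun i j => by
      obtain ⟨W⟩ := hconn i j
      induction W with
      | nil => rfl
      | cons h _ ih => exact (hg _ _ h).trans ih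
    rcases isEmpty_or_nonempty (Fin n) with h | ⟨⟨i⟩⟩
    · exact ⟨0, fun i => h.elim i⟩
    · exact ⟨g i, fun j => hreach j i⟩
  -- on each edge `y` differs by `±` the difference of the column, so the mean is a splitting
  rcases split_trivial hp hpe hd G hident x hx k (fun i => (x k i + y i) / 2) (fun i j hij => by
      rcases (pow_eq_pow_iff_cases.1 (hy i j hij)) with h0 | h0 | ⟨h0, -⟩
      · exact absurd h0 hp.ne'
      · left; linarith
      · right; linarith) with h | h
  · obtain ⟨t, ht⟩ := hconst (fun i => y i - x k i) fun i j hij => by linarith [h i j hij]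
    exact ⟨1, t, fun i => by simp [← ht i]⟩
  · obtain ⟨t, ht⟩ := hconst (fun i => y i + x k i) fun i j hij => by linarith [h i j hij]
    exact ⟨-1, t, fun i => by simp [← ht i]⟩

/-! ### Distances and isometries of `ℓ_p^d` -/

theorem dist_eq_rpow_sum_pow {p d : ℕ} (hp : 0 < p) (hpe : Even p) (x y : LpSpace p d) :
    dist x y = (∑ k, (x k - y k) ^ p) ^ (1 / (p : ℝ)) := by
  rw [PiLp.dist_eq_sum (by simpa using hp)]
  simp [Real.dist_eq, hpe.pow_abs]

theorem dist_eq_dist_iff_sum_pow {p d : ℕ} (hp : 0 < p) (hpe : Even p) (x y z w : LpSpace p d) :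
    dist x y = dist z w ↔ ∑ k, (x k - y k) ^ p = ∑ k, (z k - w k) ^ p := by
  rw [dist_eq_rpow_sum_pow hp hpe, dist_eq_rpow_sum_pow hp hpe]
  exact Real.rpow_left_inj (Finset.sum_nonneg fun k _ => hpe.pow_nonneg _)
    (Finset.sum_nonneg fun k _ => hpe.pow_nonneg _) (by positivity)

/-- The signed permutation of the coordinates followed by a translation, as a bijection of
`ℓ_p^d`. -/
def signedPermAdd {p d : ℕ} (σ : Equiv.Perm (Fin d)) (ε : Fin d → ℤˣ) (t : Fin d → ℝ) :
    LpSpace p d ≃ LpSpace p d where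
  toFun x := WithLp.toLp _ fun k => ((ε k : ℤ) : ℝ) * x (σ k) + t k
  invFun y := WithLp.toLp _ fun k =>
    ((ε (σ.symm k) : ℤ) : ℝ) * (y (σ.symm k) - t (σ.symm k))
  left_inv x := by
    ext k
    simp [← mul_assoc, ← Int.cast_mul, ← Units.val_mul]
  right_inv y := by
    ext k
    simp [← mul_assoc, ← Int.cast_mul, ← Units.val_mul]

theorem dist_signedPermAdd {p d : ℕ} (hp : 0 < p) (hpe : Even p) (σ : Equiv.Perm (Fin d))
    (ε : Fin d → ℤˣ) (t : Fin d → ℝ) (x y : LpSpace p d) :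
    dist (signedPermAdd σ ε t x) (signedPermAdd σ ε t y) = dist x y := by
  rw [dist_eq_dist_iff_sum_pow hp hpe, ← Equiv.sum_comp σ fun k => (x k - y k) ^ p]
  refine Finset.sum_congr rfl fun k _ => ?_
  rcases Int.units_eq_one_or (ε k) with h | h
  · simp [signedPermAdd, h]
  · rw [← hpe.neg_pow (x _ - _)]
    simp only [signedPermAdd, Equiv.coe_fn_mk, h]
    congr 1
    simp
    ring

end LpRigidity

theorem proposition3p3 (p d n : ℕ) (hp_pos : 0 < p) (hp_even : Even p) (hd : 2 ≤ d) (hn : 3 ≤ n)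
    (G : SimpleGraph (Fin n)) (hG : ∀ v, ¬ G.IsIsolated v)
    (hident : LpRigidity.IsIdentifiable d (LpRigidity.projectedCayleyMenger G p))
    (P : Fin n → LpRigidity.LpSpace p d) (hP : LpRigidity.IsGenericConfig P) :
    LpRigidity.IsGloballyRigid G P := by
  intro Q hQ
  obtain ⟨σ, hσ⟩ := LpRigidity.exists_perm_pow_sub_eq hp_pos hp_even G hident
    (fun k i => P i k) hP (fun k i => Q i k) fun i j hij =>
      ((LpRigidity.dist_eq_dist_iff_sum_pow hp_pos hp_even _ _ _ _).1 (hQ i j hij)).symm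
  choose ε t h using fun k => LpRigidity.exists_sign_of_pow_sub_eq hp_pos hp_even hd G hG hident
    (fun k i => P i k) hP (σ k) (fun i => Q i k) (hσ k)
  refine ⟨LpRigidity.signedPermAdd σ ε t,
    LpRigidity.dist_signedPermAdd hp_pos hp_even σ ε t, fun i => ?_⟩
  ext k
  exact h k i
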